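/- Let $m\ge 0$, let $X=\{x_0,x_1,\dots,x_m\}$ be an alphabet of noncommuting letters, let $X^*$ be the set of words over $X$ with empty word $\emptyset$, and let $|\eta|_{x_j}$ be the number of occurrences of $x_j$ in $\eta$. Let $\mathbb R\langle\langle X\rangle\rangle$ be the set of formal series $c=\sum_{\eta\in X^*}(c,\eta)\,\eta$ with $(c,\eta)\in\mathbb R$, and let $\mathbb R^m\langle\langle X\rangle\rangle$ be the set of $m$-tuples $c=(c_1,\dots,c_m)$ of such series. Write $\sqcup\!\sqcup$ for the shuffle product. For $d\in\mathbb R^m\langle\langle X\rangle\rangle$ put $d_0:=0$, $\phi_d(x_i)(e):=x_ie+x_0(d_i\sqcup\!\sqcup e)$ for $e\in\mathbb R\langle\langle X\rangle\rangle$, $\phi_d(x_{i_1}\cdots x_{i_k}):=\phi_d(x_{i_1})\circ\cdots\circ\phi_d(x_{i_k})$ and $\phi_d(\emptyset):=\mathrm{id}$. For $c,d\in\mathbb R^m\langle\langle X\rangle\rangle$ let $$(c\,\tilde\circ\, d)_i:=\sum_{\eta\in X^*}(c_i,\eta)\,\phi_d(\eta)(1),\qquad c\circledcirc d:=d+c\,\tilde\circ\,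 d .$$ Let $H$ be the free commutative unital $\mathbb R$-algebra, with product $\mu$ and unit $\mathbf 1$, on the coordinate maps $a^i_\eta: c\mapsto (c_i,\eta)$, $1\le i\le m$, $\eta\in X^*$. Elements of $H$ are evaluated at $c\in\mathbb R^m\langle\langle X\rangle\rangle$, and elements of $H\otimes H$ at pairs $(c,d)$ by $(a\otimes b)(c,d)=a(c)\,b(d)$. Let $H_n$ be the span of the monomials $a^{i_1}_{\eta_1}\cdots a^{i_r}_{\eta_r}$ of total degree $n$, where $\deg a^i_\eta=2|\eta|_{x_0}+\sum_{j=1}^m|\eta|_{x_j}+1$. **Theorem.** There is exactly one algebra morphism $\Delta:H\to H\otimes H$ such that $$(\Delta a^i_\eta)(c,d)=((c\circledcirc d)_i,\eta)\qquad\text{for all } i,\ \eta,\ \text{and all } c,d\in\mathbb R^m\langle\langle X\rangle\rangle .$$ With this coproduct, and with the counit $\varepsilon$ given by the algebra morphism $\varepsilon(a^i_\eta)=0$, $(H,\mu,\Delta)$ is a connected graded commutative unital Hopf algebra. That is: $\Delta$ is coassociative and $\varepsilon$ is a counit for it; $H=\bigoplus_{n\ge0}H_n$ with $H_kH_l\subseteq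 H_{k+l}$, $H_0=\mathbb R\mathbf 1$, $\Delta H_n\subseteq\bigoplus_{k+l=n}H_k\otimes H_l$ and $\varepsilon(H_n)=0$ for $n>0$; and there is an antipode $S:H\to H$, that is, a linear map with $\mu\circ(S\otimes\mathrm{id})\circ\Delta=\mu\circ(\mathrm{id}\otimes S)\circ\Delta=\varepsilon(\cdot)\mathbf 1$, which moreover satisfies $S(xy)=S(y)S(x)$ and $S(H_n)\subseteq H_n$. -/

import Mathlib

open scoped TensorProduct

noncomputable section

namespace OutputFeedback

/-- Words over the alphabet `x_0, x_1, …, x_m`; the letter `x_i` is `i : Fin (m + 1)`. -/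
abbrev Word (m : ℕ) := List (Fin (m + 1))

/-- Formal power series in `x_0, …, x_m` with real coefficients: `c η` is `(c, η)`. -/
abbrev Series (m : ℕ) := Word m → ℝ

/-- Series with coefficients in `ℝ^m`, given by their `m` component series; the component `c_j`,
`1 ≤ j ≤ m`, has index `j - 1 : Fin m` and corresponds to the letter `(j - 1).succ`. -/
abbrev VSeries (m : ℕ) := Fin m → Series m

/-- The shuffle product of two words, as the multiset of the words that occur in it. -/
def shuffleWord {m : ℕ} : Word m → Word m → Multiset (Word m)
  | [], ξ => {ξ}
  | i :: η, [] => {i :: η}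
  | i :: η, j :: ξ =>
      (shuffleWord η (j :: ξ)).map (i :: ·) + (shuffleWord (i :: η) ξ).map (j :: ·)
termination_by η ξ => η.length + ξ.length

/-- The shuffle product of two series, `∑_{η, ξ} (c, η) (d, ξ) η ⧢ ξ`. -/
def shuffle {m : ℕ} (c d : Series m) : Series m := fun ζ =>
  ∑ᶠ p : Word m × Word m, c p.1 * d p.2 * ((shuffleWord p.1 p.2).count ζ : ℝ)

/-- The series `x_i e`. -/
def letterMul {m : ℕ} (i : Fin (m + 1)) (e : Series m) : Series m
  | [] => 0
  | j :: η => if j = i then e η else 0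

/-- The series `1`. -/
def oneSeries (m : ℕ) : Series m
  | [] => 1
  | _ :: _ => 0

/-- `φ_d(x_i)(e) = x_i e + x_0 (d_i ⧢ e)`, where `d_0 = 0`. -/
def phiLetter {m : ℕ} (d : VSeries m) (i : Fin (m + 1)) (e : Series m) : Series m :=
  letterMul i e + letterMul 0 (shuffle (Fin.cases 0 d i) e)

/-- `φ_d(x_{i_1} ⋯ x_{i_k}) = φ_d(x_{i_1}) ∘ ⋯ ∘ φ_d(x_{i_k})`. -/
def phi {m : ℕ} (d : VSeries m) : Word m → Series m → Series m
  | [], e => e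
  | i :: η, e => phiLetter d i (phi d η e)

/-- The modified composition product `∑_η (c, η) φ_d(η)(1)` of a scalar series `c` with `d`. -/
def modComp {m : ℕ} (c : Series m) (d : VSeries m) : Series m := fun ξ =>
  ∑ᶠ η : Word m, c η * phi d η (oneSeries m) ξ

/-- The product `c ⊚ d = d + c ∘̃ d` of the output feedback group. -/
def feedbackProd {m : ℕ} (c d : VSeries m) : VSeries m := fun i => d i + modComp (c i) d

/-- The free commutative unital algebra on the coordinate maps `a^i_η`. -/
abbrev H (m : ℕ) := MvPolynomial (Fin m × Word m) ℝ

/-- The coordinate map `a^i_η` as a generator of `H`. -/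
def coord {m : ℕ} (i : Fin m) (η : Word m) : H m := MvPolynomial.X (i, η)

/-- Evaluation of the elements of `H` at a series `c`: it sends `a^i_η` to `(c_i, η)`. -/
def evalAt {m : ℕ} (c : VSeries m) : H m →ₐ[ℝ] ℝ := MvPolynomial.aeval fun p => c p.1 p.2

/-- Evaluation of the elements of `H ⊗ H` at a pair of series: `(a ⊗ b)(c, d) = a(c) b(d)`. -/
def evalPair {m : ℕ} (c d : VSeries m) : H m ⊗[ℝ] H m →ₐ[ℝ] ℝ :=
  Algebra.TensorProduct.productMap (evalAt c) (evalAt d)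

/-- `Δ` is an algebra morphism dual to the group product: `(Δ a^i_η)(c, d) = ((c ⊚ d)_i, η)`. -/
def IsDualCoproduct {m : ℕ} (Δ : H m →ₐ[ℝ] H m ⊗[ℝ] H m) : Prop :=
  ∀ (i : Fin m) (η : Word m) (c d : VSeries m),
    evalPair c d (Δ (coord i η)) = feedbackProd c d i η

/-- The counit: `ε(a^i_η) = 0`, `ε(1) = 1`. -/
def counit (m : ℕ) : H m →ₐ[ℝ] ℝ := MvPolynomial.aeval fun _ => 0

/-- `deg a^i_η = 2 |η|_{x_0} + ∑_{j = 1}^m |η|_{x_j} + 1`. -/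
def deg {m : ℕ} (p : Fin m × Word m) : ℕ :=
  2 * p.2.count 0 + ∑ j : Fin m, p.2.count j.succ + 1

/-- `H_n`, the elements of `H` of degree `n`. -/
def grading (m : ℕ) (n : ℕ) : Submodule ℝ (H m) :=
  MvPolynomial.weightedHomogeneousSubmodule ℝ deg n

/-- `(A ⊗ A)_n = ∑_{k + l = n} A_k ⊗ A_l` inside `A ⊗ A`. -/
def tensorGrading {A : Type*} [CommRing A] [Algebra ℝ A] (𝒜 : ℕ → Submodule ℝ A) (n : ℕ) :
    Submodule ℝ (A ⊗[ℝ] A) :=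
  ⨆ p ∈ Finset.HasAntidiagonal.antidiagonal n,
    LinearMap.range (TensorProduct.map (𝒜 p.1).subtype (𝒜 p.2).subtype)

/-- The commutative unital algebra `A`, with its subspaces `𝒜 n` and with the algebra morphisms
`Δ` and `ε` as coproduct and counit, is a connected graded Hopf algebra. -/
structure IsConnectedGradedHopfAlgebra {A : Type*} [CommRing A] [Algebra ℝ A]
    (𝒜 : ℕ → Submodule ℝ A) (Δ : A →ₐ[ℝ] A ⊗[ℝ] A) (ε : A →ₐ[ℝ] ℝ) : Prop where
  coassoc : (Algebra.TensorProduct.assoc ℝ ℝ ℝ A A A).toAlgHom.comp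
      ((Algebra.TensorProduct.map Δ (.id ℝ A)).comp Δ)
      = (Algebra.TensorProduct.map (.id ℝ A) Δ).comp Δ
  counit_left : (Algebra.TensorProduct.map ε (.id ℝ A)).comp Δ
      = (Algebra.TensorProduct.lid ℝ A).symm
  counit_right : (Algebra.TensorProduct.map (.id ℝ A) ε).comp Δ
      = (Algebra.TensorProduct.rid ℝ ℝ A).symm
  /-- `A` is the direct sum of the `A_n`. -/
  isInternal : DirectSum.IsInternal 𝒜
  /-- `1 ∈ A_0` and `A_k A_l ⊆ A_{k+l}`. -/
  gradedMonoid : SetLike.GradedMonoid 𝒜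
  /-- `A_0 = ℝ 1`. -/
  connected : 𝒜 0 = Submodule.span ℝ {1}
  /-- `Δ A_n ⊆ (A ⊗ A)_n`. -/
  comul_mem : ∀ n, ∀ a ∈ 𝒜 n, Δ a ∈ tensorGrading 𝒜 n
  /-- `ε` vanishes on `A_n` for `n > 0`. -/
  counit_eq_zero : ∀ n, 0 < n → ∀ a ∈ 𝒜 n, ε a = 0
  /-- The bialgebra has an antipode, antimultiplicative and of degree zero. -/
  exists_antipode : ∃ h : HopfAlgebra ℝ A,
    h.toBialgebra = Bialgebra.ofAlgHom Δ ε coassoc counit_left counit_right ∧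
    (∀ a b, h.antipode (a * b) = h.antipode b * h.antipode a) ∧
    ∀ n, ∀ a ∈ 𝒜 n, h.antipode a ∈ 𝒜 n

/-! The sums that define the two products have only finitely many nonzero terms. -/

theorem length_of_mem_shuffleWord {m : ℕ} (η ξ ζ : Word m) (h : ζ ∈ shuffleWord η ξ) :
    ζ.length = η.length + ξ.length := by
  fun_induction shuffleWord η ξ generalizing ζ with
  | case1 ξ => simp_all
  | case2 i η => simp_all
  | case3 i η j ξ ih1 ih2 =>
    simp only [Multiset.mem_add, Multiset.mem_map] at h
    rcases h with ⟨ζ', h, rfl⟩ | ⟨ζ', h, rfl⟩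
    · have := ih1 ζ' h
      simp only [List.length_cons] at *
      omega
    · have := ih2 ζ' h
      simp only [List.length_cons] at *
      omega

theorem finite_words_length_le (m n : ℕ) : {η : Word m | η.length ≤ n}.Finite :=
  List.finite_length_le _ n

theorem shuffle_finite_support {m : ℕ} (c d : Series m) (ζ : Word m) :
    (Function.support fun p : Word m × Word m =>
      c p.1 * d p.2 * ((shuffleWord p.1 p.2).count ζ : ℝ)).Finite := by
  refine ((finite_words_length_le m ζ.length).prod
    (finite_words_length_le m ζ.length)).subset ?_
  rintro ⟨η, ξ⟩ hp
  have hc : (shuffleWord η ξ).count ζ ≠ 0 := by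
    intro h0
    simp [h0] at hp
  have := length_of_mem_shuffleWord η ξ ζ (Multiset.count_ne_zero.mp hc)
  simp only [Set.mem_prod, Set.mem_ofPred_eq]
  omega

theorem shuffle_eq_zero {m : ℕ} (c e : Series m) (n : ℕ) (he : ∀ ξ : Word m, ξ.length < n → e ξ = 0)
    (ζ : Word m) (hζ : ζ.length < n) : shuffle c e ζ = 0 := by
  unfold shuffle
  rw [← finsum_zero (α := Word m × Word m)]
  refine finsum_congr fun p => ?_
  by_cases hc : ζ ∈ shuffleWord p.1 p.2
  · have := length_of_mem_shuffleWord _ _ _ hc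
    rw [he p.2 (by omega)]
    simp
  · simp [Multiset.count_eq_zero_of_notMem hc]

theorem phi_eq_zero {m : ℕ} (d : VSeries m) (η ξ : Word m) (h : ξ.length < η.length) :
    phi d η (oneSeries m) ξ = 0 := by
  induction η generalizing ξ with
  | nil => simp at h
  | cons i η ih =>
    cases ξ with
    | nil => simp [phi, phiLetter, letterMul]
    | cons j ξ =>
      have h' : ξ.length < η.length := by simpa using h
      simp [phi, phiLetter, letterMul, ih ξ h', shuffle_eq_zero _ _ _ ih ξ h']

theorem modComp_finite_support {m : ℕ} (c : Series m) (d : VSeries m) (ξ : Word m) :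
    (Function.support fun η : Word m => c η * phi d η (oneSeries m) ξ).Finite := by
  refine (finite_words_length_le m ξ.length).subset fun η hη => ?_
  by_contra hlt
  simp only [Set.mem_ofPred_eq, not_le] at hlt
  simp [phi_eq_zero d η ξ hlt] at hη

end OutputFeedback

end

/-!
`H` represents the functor sending a commutative `ℝ`-algebra `A` to the `m`-tuples of series over
`A`, and the formula for `c ⊚ d` makes sense over every `A`. So the Hopf algebra axioms are the
axioms of a group functor, read off at the universal points: `Δ` is the product of the two points of
`H` over `H ⊗ H`, and `S` is the inverse of the identity point. Uniqueness of `Δ` holds because a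
polynomial over `ℝ` is determined by its values, and the gradings are respected because the tuples
of homogeneous series of degree `1` form a subgroup.

The group axioms follow from coinduction in the shuffle algebra. The left quotients `∂_i` by the
letters are derivations for the shuffle product, and an ideal that is stable under all of them and
whose members have no constant term is zero. Composition with `d` intertwines `∂_0` and `∂_j` with
the derivations `∂_0 - ∑_k d_k ∂_k` and `∂_j`. This property determines composition with `d`; it
shows that composition with `d` is an algebra morphism, that `(c ∘̃ d) ∘̃ e = c ∘̃ (d ⊚ e)`, and
that composition with `d` has an inverse, whose coefficients are constant terms of iterated twisted
derivatives.
-/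

noncomputable section

namespace OutputFeedback

theorem derivation_apply_mem_span {R S : Type*} [CommSemiring R] [CommSemiring S] [Algebra R S]
    (D : Derivation R S S) {s : Set S} (hs : ∀ a ∈ s, D a ∈ Ideal.span s) {a : S}
    (ha : a ∈ Ideal.span s) : D a ∈ Ideal.span s := by
  induction ha using Submodule.span_induction with
  | mem a ha => exact hs a ha
  | zero => rw [map_zero]; exact zero_mem _
  | add a b _ _ iha ihb => rw [map_add]; exact add_mem iha ihb
  | smul b a ha ih =>
    rw [smul_eq_mul, D.leibniz, smul_eq_mul, smul_eq_mul]
    exact add_mem (Ideal.mul_mem_left _ _ ih) (Ideal.mul_mem_right _ _ ha)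

/-- The shuffle algebra of formal power series in noncommuting letters `α` over `A`, where `c η` is
the coefficient of the word `η`. It is a type synonym because its multiplication is the shuffle
product, not the pointwise one. -/
def ShuffleSeries (α A : Type*) := List α → A

namespace ShuffleSeries

variable {α A B : Type*}

@[ext]
theorem ext {c d : ShuffleSeries α A} (h : ∀ η, c η = d η) : c = d := funext h

section CommSemiring

variable [CommSemiring A] [CommSemiring B]

instance : AddCommMonoid (ShuffleSeries α A) := inferInstanceAs (AddCommMonoid (List α → A))

instance : Module A (ShuffleSeries α A) := inferInstanceAs (Module A (List α → A))

@[simp] theorem zero_apply (η : List α) : (0 : ShuffleSeries α A) η = 0 := rfl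

@[simp]
theorem add_apply (c d : ShuffleSeries α A) (η : List α) : (c + d) η = c η + d η := rfl

@[simp]
theorem smul_apply (a : A) (c : ShuffleSeries α A) (η : List α) : (a • c) η = a * c η := rfl

/-- The left quotient `x_i⁻¹ c` of a series by a letter, as a linear map. It is what the Leibniz
recursion for the shuffle product needs; see `leftDeriv` for the derivation it turns out to be. -/
def leftQuotient (i : α) : ShuffleSeries α A →ₗ[A] ShuffleSeries α A where
  toFun c η := c (i :: η)
  map_add' _ _ := rfl
  map_smul' _ _ := rfl

/-- The coefficients of the shuffle product, determined by the constant term and by the rule that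
left quotients act as derivations. -/
def mulCoeff : List α → ShuffleSeries α A → ShuffleSeries α A → A
  | [], c, d => c [] * d []
  | i :: ζ, c, d => mulCoeff ζ (leftQuotient i c) d + mulCoeff ζ c (leftQuotient i d)

instance : Mul (ShuffleSeries α A) := ⟨fun c d ζ => mulCoeff ζ c d⟩

instance : One (ShuffleSeries α A) := ⟨fun η => if η = [] then 1 else 0⟩

@[simp] theorem one_nil : (1 : ShuffleSeries α A) [] = 1 := rfl

@[simp]
theorem mul_nil (c d : ShuffleSeries α A) : (c * d) [] = c [] * d [] := rfl

theorem mul_cons (c d : ShuffleSeries α A) (i : α) (ζ : List α) :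
    (c * d) (i :: ζ) = (leftQuotient i c * d) ζ + (c * leftQuotient i d) ζ := rfl

theorem leftQuotient_one (i : α) : leftQuotient i (1 : ShuffleSeries α A) = 0 :=
  rfl

theorem leftQuotient_mul (i : α) (c d : ShuffleSeries α A) :
    leftQuotient i (c * d) = leftQuotient i c * d + c * leftQuotient i d := rfl

protected theorem mul_comm (c d : ShuffleSeries α A) : c * d = d * c := by
  ext ζ
  induction ζ generalizing c d with
  | nil => exact mul_comm _ _
  | cons i ζ ih => rw [mul_cons, mul_cons, ih, ih c, add_comm]

protected theorem mul_add (c d e : ShuffleSeries α A) : c * (d + e) = c * d + c * e := by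
  ext ζ
  induction ζ generalizing c d e with
  | nil => exact mul_add _ _ _
  | cons i ζ ih =>
    simp only [mul_cons, map_add, ih, add_apply]
    exact add_add_add_comm _ _ _ _

protected theorem add_mul (c d e : ShuffleSeries α A) : (c + d) * e = c * e + d * e := by
  rw [ShuffleSeries.mul_comm, ShuffleSeries.mul_add, ShuffleSeries.mul_comm c,
    ShuffleSeries.mul_comm d]

protected theorem mul_zero (c : ShuffleSeries α A) : c * 0 = 0 := by
  ext ζ
  induction ζ generalizing c with
  | nil => exact mul_zero _
  | cons i ζ ih => simp only [mul_cons, map_zero, ih, zero_apply, add_zero]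

protected theorem mul_one (c : ShuffleSeries α A) : c * 1 = c := by
  ext ζ
  induction ζ generalizing c with
  | nil => exact mul_one _
  | cons i ζ ih =>
    rw [mul_cons, leftQuotient_one, ShuffleSeries.mul_zero, ih, zero_apply, add_zero]
    rfl

protected theorem mul_smul_comm (a : A) (c d : ShuffleSeries α A) : c * a • d = a • (c * d) := by
  ext ζ
  induction ζ generalizing c d with
  | nil => exact mul_left_comm _ _ _
  | cons i ζ ih =>
    rw [mul_cons, map_smul, ih, ih, smul_apply, smul_apply, smul_apply, mul_cons, mul_add]

protected theorem mul_assoc (c d e : ShuffleSeries α A) : c * d * e = c * (d * e) := by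
  ext ζ
  induction ζ generalizing c d e with
  | nil => exact mul_assoc _ _ _
  | cons i ζ ih =>
    simp only [mul_cons, leftQuotient_mul, ShuffleSeries.add_mul, ShuffleSeries.mul_add, ih,
      add_apply, add_assoc]

instance : CommSemiring (ShuffleSeries α A) where
  mul_assoc := ShuffleSeries.mul_assoc
  mul_comm := ShuffleSeries.mul_comm
  one_mul c := (ShuffleSeries.mul_comm 1 c).trans (ShuffleSeries.mul_one c)
  mul_one := ShuffleSeries.mul_one
  zero_mul c := (ShuffleSeries.mul_comm 0 c).trans (ShuffleSeries.mul_zero c)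
  mul_zero := ShuffleSeries.mul_zero
  left_distrib := ShuffleSeries.mul_add
  right_distrib := ShuffleSeries.add_mul

instance : Algebra A (ShuffleSeries α A) :=
  Algebra.ofModule (fun a c d => by rw [mul_comm, ShuffleSeries.mul_smul_comm, mul_comm d])
    fun a c d => ShuffleSeries.mul_smul_comm a c d

/-- The left quotient by a letter, as a derivation of the shuffle algebra. -/
def leftDeriv (i : α) : Derivation A (ShuffleSeries α A) (ShuffleSeries α A) where
  toLinearMap := leftQuotient i
  map_one_eq_zero' := leftQuotient_one i
  leibniz' c d := by
    rw [leftQuotient_mul, add_comm, mul_comm (leftQuotient i c)]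
    rfl

@[simp]
theorem leftDeriv_apply (i : α) (c : ShuffleSeries α A) (η : List α) :
    leftDeriv i c η = c (i :: η) := rfl

/-- The constant term `(c, ∅)`. -/
def constantCoeff : ShuffleSeries α A →ₐ[A] A where
  toFun c := c []
  map_one' := rfl
  map_mul' _ _ := rfl
  map_zero' := rfl
  map_add' _ _ := rfl
  commutes' a := mul_one a

theorem constantCoeff_apply (c : ShuffleSeries α A) : constantCoeff c = c [] := rfl

theorem ext_leftDeriv {c d : ShuffleSeries α A} (nil : c [] = d [])
    (cons : ∀ i, leftDeriv i c = leftDeriv i d) : c = d := by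
  ext η
  cases η with
  | nil => exact nil
  | cons i η => exact congrFun (cons i) η

theorem mul_apply_cons (c d : ShuffleSeries α A) (i : α) (ζ : List α) :
    (c * d) (i :: ζ) = (leftDeriv i c * d) ζ + (c * leftDeriv i d) ζ := rfl

theorem mul_apply_eq_zero {c d : ShuffleSeries α A} {n : ℕ} (hd : ∀ ξ, ξ.length < n → d ξ = 0)
    {ζ : List α} (hζ : ζ.length < n) : (c * d) ζ = 0 := by
  induction ζ generalizing c d n with
  | nil => rw [mul_nil, hd [] hζ, mul_zero]
  | cons i ζ ih =>
    rw [List.length_cons] at hζ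
    rw [mul_apply_cons, ih hd (by omega), zero_add]
    exact ih (n := n - 1) (fun ξ hξ => hd _ (by rw [List.length_cons]; omega)) (by omega)

section Prepend

variable [DecidableEq α]

/-- The series `x_i e`, as a linear function of `e`. -/
def prepend (i : α) : ShuffleSeries α A →ₗ[A] ShuffleSeries α A where
  toFun e
    | [] => 0
    | j :: η => if j = i then e η else 0
  map_add' c d := by
    ext (_ | ⟨j, η⟩)
    · exact (add_zero 0).symm
    · exact ite_add_zero
  map_smul' a c := by
    ext (_ | ⟨j, η⟩)
    · exact (mul_zero a).symm
    · exact (mul_ite_zero _ _ _).symm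

@[simp]
theorem prepend_nil (i : α) (e : ShuffleSeries α A) : prepend i e [] = 0 := rfl

theorem prepend_cons (i j : α) (e : ShuffleSeries α A) (η : List α) :
    prepend i e (j :: η) = if j = i then e η else 0 := rfl

theorem leftDeriv_prepend (i j : α) (e : ShuffleSeries α A) :
    leftDeriv j (prepend i e) = if j = i then e else 0 := by
  ext η
  rw [leftDeriv_apply, prepend_cons]
  split_ifs <;> rfl

theorem prepend_mul_prepend (i j : α) (c d : ShuffleSeries α A) :
    prepend i c * prepend j d = prepend i (c * prepend j d) + prepend j (prepend i c * d) := by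
  refine ext_leftDeriv (by simp) fun k => ?_
  simp only [Derivation.leibniz, map_add, leftDeriv_prepend, smul_eq_mul, mul_ite, mul_zero]
  rw [add_comm, mul_comm]

theorem eq_smul_one_add_sum_prepend [Fintype α] (c : ShuffleSeries α A) :
    c = c [] • 1 + ∑ i, prepend i (leftDeriv i c) := by
  refine ext_leftDeriv ?_ fun j => ?_
  · simp only [← constantCoeff_apply, map_add, map_smul, map_one, map_sum]
    simp [constantCoeff_apply]
  · simp [leftDeriv_prepend]

end Prepend

/-- The change of coefficients along a ring homomorphism. -/
def map (f : A →+* B) : ShuffleSeries α A →+* ShuffleSeries α B where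
  toFun c η := f (c η)
  map_zero' := ext fun _ => map_zero f
  map_add' _ _ := ext fun _ => map_add f _ _
  map_one' := by
    ext η
    exact (apply_ite f _ _ _).trans (by rw [map_one, map_zero]; rfl)
  map_mul' c d := by
    ext ζ
    induction ζ generalizing c d with
    | nil => exact map_mul f _ _
    | cons i ζ ih => exact (map_add f _ _).trans (congrArg₂ (· + ·) (ih _ _) (ih _ _))

@[simp]
theorem map_apply (f : A →+* B) (c : ShuffleSeries α A) (η : List α) : map f c η = f (c η) := rfl

theorem map_prepend [DecidableEq α] (f : A →+* B) (i : α) (e : ShuffleSeries α A) :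
    map f (prepend i e) = prepend i (map f e) := by
  ext (_ | ⟨j, η⟩)
  · exact map_zero f
  · simp only [map_apply, prepend_cons, apply_ite f, map_zero]

end CommSemiring

section CommRing

variable [CommRing A]

instance : CommRing (ShuffleSeries α A) where
  __ : AddCommGroup (ShuffleSeries α A) := inferInstanceAs (AddCommGroup (List α → A))
  __ : CommSemiring (ShuffleSeries α A) := inferInstance

end CommRing

section FormalSum

variable [CommSemiring A] [CommSemiring B] {κ : Type*}

/-- A family of series is locally finite if each word occurs in finitely many of them, so that the
family has a sum coefficient by coefficient. -/
def IsLocallyFinite (f : κ → ShuffleSeries α A) : Prop :=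
  ∀ ξ, Function.HasFiniteSupport fun k => f k ξ

/-- The coefficientwise sum of a family of series; `finsum` makes a coefficient `0` where the family
is not locally finite. -/
def formalSum (f : κ → ShuffleSeries α A) : ShuffleSeries α A := fun ξ => ∑ᶠ k, f k ξ

theorem formalSum_apply (f : κ → ShuffleSeries α A) (ξ : List α) :
    formalSum f ξ = ∑ᶠ k, f k ξ := rfl

theorem leftDeriv_formalSum (i : α) (f : κ → ShuffleSeries α A) :
    leftDeriv i (formalSum f) = formalSum fun k => leftDeriv i (f k) := rfl

theorem prepend_formalSum [DecidableEq α] (i : α) (f : κ → ShuffleSeries α A) :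
    prepend i (formalSum f) = formalSum fun k => prepend i (f k) := by
  refine ext_leftDeriv finsum_zero.symm fun j => ?_
  rw [leftDeriv_formalSum]
  simp only [leftDeriv_prepend]
  split_ifs
  · rfl
  · exact ext fun _ => finsum_zero.symm

variable {f g : κ → ShuffleSeries α A}

theorem IsLocallyFinite.leftDeriv (hf : IsLocallyFinite f) (i : α) :
    IsLocallyFinite fun k => leftDeriv i (f k) := fun ξ => hf (i :: ξ)

theorem IsLocallyFinite.smul (hf : IsLocallyFinite f) (a : κ → A) :
    IsLocallyFinite fun k => a k • f k :=
  fun ξ => (hf ξ).subset (Function.support_mul_subset_right a _)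

theorem IsLocallyFinite.prepend [DecidableEq α] (hf : IsLocallyFinite f) (i : α) :
    IsLocallyFinite fun k => prepend i (f k)
  | [] => Function.hasFiniteSupport_zero
  | _ :: ξ => (hf ξ).subset fun _ => mt fun h => (ite_eq_right_iff.mpr fun _ => h)

theorem IsLocallyFinite.mul_left (hf : IsLocallyFinite f) (c : ShuffleSeries α A) :
    IsLocallyFinite fun k => c * f k := by
  intro ζ
  induction ζ generalizing c f with
  | nil => exact (hf []).subset (Function.support_mul_subset_right (fun _ => c []) _)
  | cons i ζ ih => exact (ih hf _).add (ih (hf.leftDeriv i) c)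

theorem formalSum_add (hf : IsLocallyFinite f) (hg : IsLocallyFinite g) :
    formalSum (fun k => f k + g k) = formalSum f + formalSum g :=
  ext fun ξ => finsum_add_distrib (hf ξ) (hg ξ)

theorem formalSum_smul (hf : IsLocallyFinite f) (a : A) :
    formalSum (fun k => a • f k) = a • formalSum f :=
  ext fun ξ => (mul_finsum' _ _ (hf ξ)).symm

theorem mul_formalSum (hf : IsLocallyFinite f) (c : ShuffleSeries α A) :
    c * formalSum f = formalSum fun k => c * f k := by
  ext ζ
  induction ζ generalizing c f with
  | nil => exact mul_finsum' _ _ (hf [])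
  | cons i ζ ih =>
    calc (c * formalSum f) (i :: ζ)
      _ = (leftDeriv i c * formalSum f) ζ + (c * formalSum fun k => leftDeriv i (f k)) ζ := rfl
      _ = ∑ᶠ k, (leftDeriv i c * f k) ζ + ∑ᶠ k, (c * leftDeriv i (f k)) ζ := by
        rw [ih hf, ih (hf.leftDeriv i)]; rfl
      _ = _ := (finsum_add_distrib (hf.mul_left _ ζ) ((hf.leftDeriv i).mul_left c ζ)).symm

theorem map_formalSum (φ : A →+* B) (hf : IsLocallyFinite f) :
    map φ (formalSum f) = formalSum fun k => map φ (f k) :=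
  ext fun ξ => map_finsum φ (hf ξ)

theorem formalSum_eq_formalSum_comp {κ' : Type*} {e : κ' → κ} (he : e.Injective)
    (hf : ∀ k ∉ Set.range e, f k = 0) : formalSum f = formalSum (f ∘ e) := by
  ext ξ
  have supp : Function.support (fun k => f k ξ) ⊆ Set.range e := fun k hk => by
    by_contra h
    exact hk (congrFun (hf k h) ξ)
  rw [formalSum_apply, ← finsum_mem_univ,
    ← finsum_mem_inter_support_eq _ (Set.range e) _ (by simp [Set.inter_eq_right.mpr supp]),
    finsum_mem_range he]
  rfl

end FormalSum

section Coinduction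

variable [CommRing A]

/-- Every coefficient is the constant term of an iterated left quotient. -/
theorem eq_bot_of_leftDeriv_mem {I : Ideal (ShuffleSeries α A)} (nil : ∀ c ∈ I, c [] = 0)
    (cons : ∀ i, ∀ c ∈ I, leftDeriv i c ∈ I) : I = ⊥ := by
  refine (Submodule.eq_bot_iff I).mpr fun c hc => ext fun η => ?_
  induction η generalizing c with
  | nil => exact nil c hc
  | cons i _ ih => exact ih _ (cons i c hc)

end Coinduction

section Composition

variable {m : ℕ}

section CommSemiring

variable [CommSemiring A] [CommSemiring B] (d : Fin m → ShuffleSeries (Fin (m + 1)) A)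

/-- The series `φ_d(η)(1)` that composition with `d` substitutes for the word `η`. -/
def wordImage : List (Fin (m + 1)) → ShuffleSeries (Fin (m + 1)) A
  | [] => 1
  | i :: η => prepend i (wordImage η) + prepend 0 (Fin.cases 0 d i * wordImage η)

theorem wordImage_apply_eq_zero {η ξ : List (Fin (m + 1))} (h : ξ.length < η.length) :
    wordImage d η ξ = 0 := by
  induction η generalizing ξ with
  | nil => exact absurd h (Nat.not_lt_zero _)
  | cons i η ih =>
    cases ξ with
    | nil => exact add_zero 0
    | cons j ξ =>
      have hξ : ξ.length < η.length := Nat.lt_of_succ_lt_succ h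
      simp only [wordImage, add_apply, prepend_cons, ih hξ,
        mul_apply_eq_zero (fun _ => ih) hξ, ite_self, add_zero]

theorem isLocallyFinite_wordImage : IsLocallyFinite (wordImage d) := fun ξ =>
  (List.finite_length_le _ ξ.length).subset fun _ hη =>
    not_lt.mp fun h => hη (wordImage_apply_eq_zero d h)

/-- The modified composition product `c ∘̃ d`, as a linear function of `c`. -/
def comp : ShuffleSeries (Fin (m + 1)) A →ₗ[A] ShuffleSeries (Fin (m + 1)) A where
  toFun c := formalSum fun η => c η • wordImage d η
  map_add' c c' := by
    simp only [add_apply, add_smul]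
    exact formalSum_add ((isLocallyFinite_wordImage d).smul c)
      ((isLocallyFinite_wordImage d).smul c')
  map_smul' a c := by
    simp only [smul_apply, mul_smul]
    exact formalSum_smul ((isLocallyFinite_wordImage d).smul c) a

theorem comp_eq_formalSum (c : ShuffleSeries (Fin (m + 1)) A) :
    comp d c = formalSum fun η => c η • wordImage d η := rfl

theorem comp_one : comp d 1 = 1 := by
  ext ξ
  rw [comp_eq_formalSum, formalSum_apply, finsum_eq_single _ [] fun η hη => ?_]
  · exact one_mul _
  · exact (congrArg (· * _) (if_neg hη)).trans (zero_mul _)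

theorem comp_prepend (i : Fin (m + 1)) (e : ShuffleSeries (Fin (m + 1)) A) :
    comp d (prepend i e) = prepend i (comp d e) + prepend 0 (Fin.cases 0 d i * comp d e) := by
  have cons_injective : (List.cons i).Injective := List.cons_injective
  have supp : ∀ η ∉ Set.range (List.cons i), prepend i e η • wordImage d η = 0
    | [], _ => zero_smul _ _
    | j :: η, h => by rw [prepend_cons, if_neg (by rintro rfl; exact h ⟨η, rfl⟩), zero_smul]
  have fin : IsLocallyFinite fun η => e η • wordImage d η := (isLocallyFinite_wordImage d).smul e
  calc comp d (prepend i e)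
    _ = formalSum fun η => e η • wordImage d (i :: η) := by
      rw [comp_eq_formalSum, formalSum_eq_formalSum_comp cons_injective supp]
      simp only [Function.comp_def, prepend_cons, if_true]
    _ = formalSum fun η => prepend i (e η • wordImage d η)
          + prepend 0 (Fin.cases 0 d i * e η • wordImage d η) := by
      simp only [wordImage, smul_add, map_smul, mul_smul_comm]
    _ = _ := by
      rw [formalSum_add (fin.prepend i) ((fin.mul_left _).prepend 0), comp_eq_formalSum,
        prepend_formalSum, mul_formalSum fin, prepend_formalSum]

theorem comp_eq_sum_prepend (c : ShuffleSeries (Fin (m + 1)) A) :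
    comp d c = c [] • 1 + ∑ i, prepend i (comp d (leftDeriv i c))
      + prepend 0 (∑ k : Fin m, d k * comp d (leftDeriv k.succ c)) := by
  conv_lhs => rw [eq_smul_one_add_sum_prepend c]
  simp [comp_one, comp_prepend, Finset.sum_add_distrib, Fin.sum_univ_succ (n := m), add_assoc]

theorem comp_nil (c : ShuffleSeries (Fin (m + 1)) A) : comp d c [] = c [] := by
  change constantCoeff (comp d c) = c []
  rw [comp_eq_sum_prepend]
  simp only [map_add, map_smul, map_sum, map_one]
  simp [constantCoeff_apply]

theorem map_wordImage (φ : A →+* B) (η : List (Fin (m + 1))) :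
    map φ (wordImage d η) = wordImage (fun i => map φ (d i)) η := by
  induction η with
  | nil => exact map_one _
  | cons i η ih =>
    have map_cases : map φ (Fin.cases 0 d i) = Fin.cases 0 (fun j => map φ (d j)) i := by
      cases i using Fin.cases with
      | zero => exact map_zero _
      | succ j => rfl
    simp only [wordImage, map_add, map_prepend, map_mul, ih, map_cases]

theorem map_comp (φ : A →+* B) (c : ShuffleSeries (Fin (m + 1)) A) :
    map φ (comp d c) = comp (fun i => map φ (d i)) (map φ c) := by
  rw [comp_eq_formalSum, map_formalSum φ ((isLocallyFinite_wordImage d).smul c), comp_eq_formalSum]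
  congr! 2 with η
  rw [← map_wordImage]
  exact ext fun ξ => map_mul φ _ _

end CommSemiring

section CommRing

variable [CommRing A] (d e : Fin m → ShuffleSeries (Fin (m + 1)) A)

/-- The left derivations twisted by `d`: `∂_0 - ∑_k d_k ∂_k` for the letter `x_0`, and `∂_j` for the
others. Composition with `d` intertwines them with the untwisted ones, see `feedbackDeriv_comp`. -/
def feedbackDeriv (i : Fin (m + 1)) :
    Derivation A (ShuffleSeries (Fin (m + 1)) A) (ShuffleSeries (Fin (m + 1)) A) :=
  Fin.cases (leftDeriv 0 - ∑ k : Fin m, d k • leftDeriv k.succ) (fun j => leftDeriv j.succ) i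

theorem feedbackDeriv_succ (j : Fin m) : feedbackDeriv d j.succ = leftDeriv j.succ := rfl

theorem feedbackDeriv_zero_apply (c : ShuffleSeries (Fin (m + 1)) A) :
    feedbackDeriv d 0 c = leftDeriv 0 c - ∑ k, d k * leftDeriv k.succ c := by
  have sum_apply := congrFun (map_sum (Derivation.coeFnAddMonoidHom (R := A))
    (fun k : Fin m => d k • leftDeriv k.succ) Finset.univ) c
  rw [Finset.sum_apply] at sum_apply
  exact congrArg (leftDeriv 0 c - ·) sum_apply

theorem leftDeriv_zero_eq (c : ShuffleSeries (Fin (m + 1)) A) :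
    leftDeriv 0 c = feedbackDeriv d 0 c + ∑ k : Fin m, d k * feedbackDeriv d k.succ c := by
  simp only [feedbackDeriv_zero_apply, feedbackDeriv_succ, sub_add_cancel]

theorem feedbackDeriv_comp (i : Fin (m + 1)) (c : ShuffleSeries (Fin (m + 1)) A) :
    feedbackDeriv d i (comp d c) = comp d (leftDeriv i c) := by
  cases i using Fin.cases with
  | zero => simp [feedbackDeriv_zero_apply, comp_eq_sum_prepend d c, leftDeriv_prepend]
  | succ j => simp [feedbackDeriv_succ, comp_eq_sum_prepend d c, leftDeriv_prepend]

/-- A coinduction principle: the ideal generated by the differences `f x - g x` is stable under all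
left derivations and consists of series without constant term, hence vanishes. -/
theorem eq_of_feedbackDeriv_sub_mem_span {ι : Type*} {f g : ι → ShuffleSeries (Fin (m + 1)) A}
    (nil : ∀ x, f x [] = g x [])
    (cons : ∀ i x, feedbackDeriv d i (f x - g x) ∈ Ideal.span (Set.range (f - g))) (x : ι) :
    f x = g x := by
  set I := Ideal.span (Set.range (f - g))
  have nil_mem (c) (hc : c ∈ I) : c [] = 0 := by
    have le_ker : I ≤ RingHom.ker constantCoeff :=
      Ideal.span_le.mpr <| Set.range_subset_iff.mpr fun x => sub_eq_zero.mpr (nil x)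
    exact le_ker hc
  have deriv_mem (i) (c) (hc : c ∈ I) : feedbackDeriv d i c ∈ I :=
    derivation_apply_mem_span _ (Set.forall_mem_range.mpr (cons i)) hc
  have leftDeriv_mem (i) (c) (hc : c ∈ I) : leftDeriv i c ∈ I := by
    cases i using Fin.cases with
    | zero =>
      rw [leftDeriv_zero_eq d]
      exact add_mem (deriv_mem _ c hc) (sum_mem fun k _ => I.mul_mem_left _ (deriv_mem _ c hc))
    | succ j => exact deriv_mem j.succ c hc
  have mem : f x - g x ∈ I := Ideal.subset_span ⟨x, rfl⟩
  rw [eq_bot_of_leftDeriv_mem nil_mem leftDeriv_mem] at mem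
  exact sub_eq_zero.mp mem

theorem comp_mul (a b : ShuffleSeries (Fin (m + 1)) A) :
    comp d (a * b) = comp d a * comp d b := by
  let f (p : ShuffleSeries (Fin (m + 1)) A × ShuffleSeries (Fin (m + 1)) A) := comp d (p.1 * p.2)
  let g (p : ShuffleSeries (Fin (m + 1)) A × ShuffleSeries (Fin (m + 1)) A) :=
    comp d p.1 * comp d p.2
  refine eq_of_feedbackDeriv_sub_mem_span d (f := f) (g := g) (fun p => ?_) (fun i p => ?_) (a, b)
  · simp only [f, g, comp_nil, mul_nil]
  · have leibniz : feedbackDeriv d i (f p - g p) =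
        (f - g) (p.1, leftDeriv i p.2) + (f - g) (p.2, leftDeriv i p.1) := by
      simp only [f, g, Pi.sub_apply, map_sub, map_add, feedbackDeriv_comp, Derivation.leibniz,
        smul_eq_mul]
      ring
    rw [leibniz]
    exact add_mem (Ideal.subset_span ⟨_, rfl⟩) (Ideal.subset_span ⟨_, rfl⟩)

theorem eq_comp_of_feedbackDeriv
    {T : ShuffleSeries (Fin (m + 1)) A → ShuffleSeries (Fin (m + 1)) A}
    (nil : ∀ c, T c [] = c []) (cons : ∀ i c, feedbackDeriv d i (T c) = T (leftDeriv i c))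
    (c : ShuffleSeries (Fin (m + 1)) A) : T c = comp d c := by
  refine eq_of_feedbackDeriv_sub_mem_span d (g := comp d) (fun c => ?_) (fun i c => ?_) c
  · rw [nil, comp_nil]
  · rw [map_sub, cons, feedbackDeriv_comp]
    exact Ideal.subset_span ⟨leftDeriv i c, rfl⟩

theorem feedbackDeriv_add_comp (i : Fin (m + 1)) (c : ShuffleSeries (Fin (m + 1)) A) :
    feedbackDeriv (fun j => e j + comp e (d j)) i (comp e c) = comp e (feedbackDeriv d i c) := by
  cases i using Fin.cases with
  | zero =>
    have h (k : Fin m) : leftDeriv k.succ (comp e c) = comp e (leftDeriv k.succ c) :=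
      feedbackDeriv_comp e k.succ c
    simp only [feedbackDeriv_zero_apply, h, leftDeriv_zero_eq e (comp e c), feedbackDeriv_comp,
      map_sub, map_sum, comp_mul, add_mul, Finset.sum_add_distrib]
    abel
  | succ j => exact feedbackDeriv_comp e j.succ c

theorem comp_comp (c : ShuffleSeries (Fin (m + 1)) A) :
    comp e (comp d c) = comp (fun j => e j + comp e (d j)) c :=
  eq_comp_of_feedbackDeriv _ (T := fun c => comp e (comp d c))
    (fun c => by rw [comp_nil, comp_nil])
    (fun i c => by rw [feedbackDeriv_add_comp, feedbackDeriv_comp]) c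

/-- The inverse of composition with `d`: its coefficients are the constant terms of iterated twisted
derivatives. -/
def compInv : ShuffleSeries (Fin (m + 1)) A → ShuffleSeries (Fin (m + 1)) A
  | g, [] => g []
  | g, i :: ζ => compInv (feedbackDeriv d i g) ζ

theorem comp_compInv (g : ShuffleSeries (Fin (m + 1)) A) : comp d (compInv d g) = g :=
  eq_of_feedbackDeriv_sub_mem_span d (f := fun g => comp d (compInv d g)) (g := id)
    (fun g => comp_nil d _)
    (fun i g => by
      rw [map_sub, feedbackDeriv_comp]
      exact Ideal.subset_span ⟨feedbackDeriv d i g, rfl⟩) g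

end CommRing

end Composition

section Homogeneous

variable {ι σ : Type*} [AddCommMonoid ι] [CommSemiring A] [SetLike σ A] {𝒜 : ι → σ} {w : α → ι}
  {k l : ι} {c d : ShuffleSeries α A}

variable (𝒜 w k c) in
/-- Homogeneity of degree `k` of a series with coefficients in a graded ring, where the letter `i`
has degree `-w i`: the word `η` of weight `n` may have coefficients of degree `n + k` only. -/
def IsHomogeneous : Prop := ∀ η : List α, c η ∈ 𝒜 ((η.map w).sum + k)

theorem IsHomogeneous.leftDeriv (hc : IsHomogeneous 𝒜 w k c) (i : α) :
    IsHomogeneous 𝒜 w (w i + k) (leftDeriv i c) := fun η => by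
  have h := hc (i :: η)
  rwa [List.map_cons, List.sum_cons, add_comm (w i), add_assoc] at h

variable [AddSubmonoidClass σ A]

theorem IsHomogeneous.zero : IsHomogeneous 𝒜 w k (0 : ShuffleSeries α A) := fun _ => zero_mem _

theorem IsHomogeneous.add (hc : IsHomogeneous 𝒜 w k c) (hd : IsHomogeneous 𝒜 w k d) :
    IsHomogeneous 𝒜 w k (c + d) := fun η => add_mem (hc η) (hd η)

theorem IsHomogeneous.prepend [DecidableEq α] {i : α} (hc : IsHomogeneous 𝒜 w (w i + k) c) :
    IsHomogeneous 𝒜 w k (prepend i c)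
  | [] => zero_mem _
  | j :: η => by
    rw [prepend_cons]
    split_ifs with h
    · rw [h, List.map_cons, List.sum_cons, add_comm (w i), add_assoc]
      exact hc η
    · exact zero_mem _

theorem IsHomogeneous.mul [SetLike.GradedMonoid 𝒜] (hc : IsHomogeneous 𝒜 w k c)
    (hd : IsHomogeneous 𝒜 w l d) : IsHomogeneous 𝒜 w (k + l) (c * d) := fun ζ => by
  induction ζ generalizing c d k l with
  | nil =>
    have h := SetLike.mul_mem_graded (hc []) (hd [])
    rwa [List.map_nil, List.sum_nil, zero_add, zero_add, ← zero_add (k + l)] at h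
  | cons i ζ ih =>
    rw [mul_apply_cons, List.map_cons, List.sum_cons, add_comm (w i), add_assoc]
    refine add_mem ?_ ?_
    · rw [← add_assoc (w i)]
      exact ih (hc.leftDeriv i) hd
    · rw [add_left_comm (w i)]
      exact ih hc (hd.leftDeriv i)

end Homogeneous

section HomogeneousComposition

variable {m k : ℕ} {σ : Type*}

/-- The degrees of the letters: `2` for `x_0` and `1` for the others. -/
def letterWeight (i : Fin (m + 1)) : ℕ := if i = 0 then 2 else 1

theorem letterWeight_succ (j : Fin m) : letterWeight j.succ = 1 := if_neg j.succ_ne_zero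

section CommSemiring

variable [CommSemiring A] [SetLike σ A] [AddSubmonoidClass σ A] {𝒜 : ℕ → σ}
  [SetLike.GradedMonoid 𝒜] {c : ShuffleSeries (Fin (m + 1)) A}
  {d : Fin m → ShuffleSeries (Fin (m + 1)) A}

/-- This is where `x_0` has to weigh one more than the other letters: `x_i` is replaced by
`x_0 d_i`, and `d_i` has degree `1`. -/
theorem isHomogeneous_smul_wordImage (hd : ∀ i, IsHomogeneous 𝒜 letterWeight 1 (d i)) {a : A}
    {η : List (Fin (m + 1))} (ha : a ∈ 𝒜 ((η.map letterWeight).sum + k)) :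
    IsHomogeneous 𝒜 letterWeight k (a • wordImage d η) := by
  induction η generalizing k with
  | nil =>
    intro ξ
    rw [smul_apply]
    cases ξ with
    | nil => simpa [wordImage] using ha
    | cons i ξ => exact (mul_zero a).symm ▸ zero_mem _
  | cons i η ih =>
    have tail : IsHomogeneous 𝒜 letterWeight (letterWeight i + k) (a • wordImage d η) :=
      ih (by rwa [List.map_cons, List.sum_cons, add_comm (letterWeight i), add_assoc] at ha)
    rw [wordImage, smul_add, ← map_smul, ← map_smul, ← mul_smul_comm]
    refine tail.prepend.add (IsHomogeneous.prepend ?_)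
    cases i using Fin.cases with
    | zero => rw [Fin.cases_zero, zero_mul]; exact .zero
    | succ j =>
      have h := (hd j).mul tail
      rwa [letterWeight_succ, ← add_assoc] at h

theorem IsHomogeneous.comp (hc : IsHomogeneous 𝒜 letterWeight k c)
    (hd : ∀ i, IsHomogeneous 𝒜 letterWeight 1 (d i)) :
    IsHomogeneous 𝒜 letterWeight k (comp d c) := fun ξ =>
  finsum_induction (· ∈ 𝒜 _) (zero_mem _) (fun _ _ => add_mem)
    fun η => isHomogeneous_smul_wordImage hd (hc η) ξ

end CommSemiring

section CommRing

variable [CommRing A] [SetLike σ A] [AddSubgroupClass σ A] {𝒜 : ℕ → σ} [SetLike.GradedMonoid 𝒜]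
  {c : ShuffleSeries (Fin (m + 1)) A} {d : Fin m → ShuffleSeries (Fin (m + 1)) A}

theorem IsHomogeneous.feedbackDeriv (hc : IsHomogeneous 𝒜 letterWeight k c)
    (hd : ∀ i, IsHomogeneous 𝒜 letterWeight 1 (d i)) (i : Fin (m + 1)) :
    IsHomogeneous 𝒜 letterWeight (letterWeight i + k) (feedbackDeriv d i c) := by
  cases i using Fin.cases with
  | zero =>
    have sum_mem : IsHomogeneous 𝒜 letterWeight (letterWeight (0 : Fin (m + 1)) + k)
        (∑ j, d j * ShuffleSeries.leftDeriv j.succ c) := by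
      refine Finset.sum_induction _ _ (fun _ _ => .add) .zero fun j _ => ?_
      have h := (hd j).mul (hc.leftDeriv j.succ)
      rwa [letterWeight_succ, ← add_assoc] at h
    rw [feedbackDeriv_zero_apply]
    exact fun η => sub_mem (hc.leftDeriv 0 η) (sum_mem η)
  | succ j => exact hc.leftDeriv j.succ

theorem IsHomogeneous.compInv (hc : IsHomogeneous 𝒜 letterWeight k c)
    (hd : ∀ i, IsHomogeneous 𝒜 letterWeight 1 (d i)) :
    IsHomogeneous 𝒜 letterWeight k (compInv d c) := fun ζ => by
  induction ζ generalizing c k with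
  | nil => exact hc []
  | cons i ζ ih =>
    rw [List.map_cons, List.sum_cons, add_comm (letterWeight i), add_assoc]
    exact ih (hc.feedbackDeriv hd i)

end CommRing

end HomogeneousComposition

end ShuffleSeries

open ShuffleSeries

/-- The output feedback group with coefficients in `A`: the `m`-tuples of series over `A` with the
product `c ⊚ d = d + c ∘̃ d`. As a functor of `A` it is represented by `H m`, see `points`. -/
def FeedbackGroup (m : ℕ) (A : Type*) := Fin m → ShuffleSeries (Fin (m + 1)) A

namespace FeedbackGroup

variable {m : ℕ} {A B : Type*}

@[ext]
theorem ext {c d : FeedbackGroup m A} (h : ∀ i η, c i η = d i η) : c = d :=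
  funext fun i => funext (h i)

variable [CommRing A] [CommRing B]

instance : Mul (FeedbackGroup m A) := ⟨fun c d i => d i + comp d (c i)⟩

instance : One (FeedbackGroup m A) := ⟨fun _ => 0⟩

instance : Inv (FeedbackGroup m A) := ⟨fun d i => compInv d (-d i)⟩

theorem mul_apply (c d : FeedbackGroup m A) (i : Fin m) : (c * d) i = d i + comp d (c i) := rfl

theorem one_apply (i : Fin m) : (1 : FeedbackGroup m A) i = 0 := rfl

theorem inv_apply (d : FeedbackGroup m A) (i : Fin m) : d⁻¹ i = compInv d (-d i) := rfl

instance : Group (FeedbackGroup m A) :=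
  Group.ofLeftAxioms
    (fun c d e => funext fun i => by
      rw [mul_apply, mul_apply, mul_apply, mul_apply, map_add, comp_comp d e, add_assoc]; rfl)
    (fun d => funext fun i => by rw [mul_apply, one_apply, map_zero, add_zero])
    fun d => funext fun i => by
      rw [mul_apply, inv_apply, comp_compInv d, one_apply, add_neg_cancel]

/-- Functoriality of the output feedback group in the coefficient ring. -/
def map (f : A →+* B) : FeedbackGroup m A →* FeedbackGroup m B :=
  MonoidHom.mk' (fun c i => ShuffleSeries.map f (c i)) fun c d => funext fun i =>
    (map_add _ _ _).trans (congrArg _ (map_comp d f (c i)))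

variable {σ : Type*} [SetLike σ A] [AddSubgroupClass σ A]

/-- The tuples of homogeneous series of degree `1`. -/
def homogeneousSubgroup (m : ℕ) (𝒜 : ℕ → σ) [SetLike.GradedMonoid 𝒜] :
    Subgroup (FeedbackGroup m A) where
  carrier := {c | ∀ i, IsHomogeneous 𝒜 letterWeight 1 (c i)}
  one_mem' _ := .zero
  mul_mem' hc hd i := (hd i).add ((hc i).comp hd)
  inv_mem' hd i := IsHomogeneous.compInv (fun η => neg_mem (hd i η)) hd

end FeedbackGroup

namespace ShuffleSeries

section WordSum

variable {α A : Type*} [DecidableEq α] [CommSemiring A]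

/-- The sum of the words in a multiset, as a series. -/
def wordSum (s : Multiset (List α)) : ShuffleSeries α A := fun ζ => s.count ζ

theorem wordSum_apply (s : Multiset (List α)) (ζ : List α) :
    (wordSum s : ShuffleSeries α A) ζ = s.count ζ := rfl

theorem wordSum_singleton_nil : (wordSum {[]} : ShuffleSeries α A) = 1 := by
  ext ζ
  rw [wordSum_apply, Multiset.count_singleton]
  exact (Nat.cast_ite ..).trans (by rw [Nat.cast_one, Nat.cast_zero]; rfl)

theorem wordSum_add (s t : Multiset (List α)) :
    (wordSum (s + t) : ShuffleSeries α A) = wordSum s + wordSum t := by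
  ext ζ
  simp only [wordSum_apply, add_apply, Multiset.count_add, Nat.cast_add]

theorem wordSum_map_cons (i : α) (s : Multiset (List α)) :
    (wordSum (s.map (i :: ·)) : ShuffleSeries α A) = prepend i (wordSum s) := by
  ext (_ | ⟨j, ζ⟩)
  · have notMem : [] ∉ s.map (i :: ·) := by simp
    rw [wordSum_apply, Multiset.count_eq_zero_of_notMem notMem, Nat.cast_zero, prepend_nil]
  · rw [wordSum_apply, prepend_cons]
    split_ifs with h
    · rw [h, Multiset.count_map_eq_count' _ _ List.cons_injective, wordSum_apply]
    · have notMem : j :: ζ ∉ s.map (i :: ·) := by simp [Ne.symm h]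
      rw [Multiset.count_eq_zero_of_notMem notMem, Nat.cast_zero]

theorem wordSum_singleton_cons (i : α) (η : List α) :
    (wordSum {i :: η} : ShuffleSeries α A) = prepend i (wordSum {η}) := by
  rw [← wordSum_map_cons, Multiset.map_singleton]

theorem wordSum_singleton_apply_of_ne {η ξ : List α} (h : η ≠ ξ) :
    (wordSum {η} : ShuffleSeries α A) ξ = 0 := by
  rw [wordSum_apply, Multiset.count_singleton, if_neg h.symm, Nat.cast_zero]

theorem isLocallyFinite_wordSum_singleton :
    IsLocallyFinite fun η : List α => (wordSum {η} : ShuffleSeries α A) := fun ξ =>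
  (Set.finite_singleton ξ).subset fun _ => not_imp_comm.mp wordSum_singleton_apply_of_ne

theorem formalSum_smul_wordSum_singleton (c : ShuffleSeries α A) :
    formalSum (fun η => c η • wordSum {η}) = c := by
  ext ξ
  rw [formalSum_apply, finsum_eq_single _ ξ fun η hη => by
    rw [smul_apply, wordSum_singleton_apply_of_ne hη, mul_zero]]
  rw [smul_apply, wordSum_apply, Multiset.count_singleton_self, Nat.cast_one, mul_one]

end WordSum

variable {m : ℕ}

theorem wordSum_shuffleWord {A : Type*} [CommSemiring A] (η ξ : Word m) :
    (wordSum (shuffleWord η ξ) : ShuffleSeries (Fin (m + 1)) A) = wordSum {η} * wordSum {ξ} := by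
  fun_induction shuffleWord η ξ with
  | case1 ξ => rw [wordSum_singleton_nil, one_mul]
  | case2 i η => rw [wordSum_singleton_nil, mul_one]
  | case3 i η j ξ ihη ihξ =>
    rw [wordSum_add, wordSum_map_cons, wordSum_map_cons, ihη, ihξ, wordSum_singleton_cons i,
      wordSum_singleton_cons j, prepend_mul_prepend]

end ShuffleSeries

section RealCoefficients

variable {m : ℕ}

theorem shuffle_eq_mul (c d : ShuffleSeries (Fin (m + 1)) ℝ) : shuffle c d = c * d := by
  let term (c : ShuffleSeries (Fin (m + 1)) ℝ) (η : Word m) : ShuffleSeries (Fin (m + 1)) ℝ :=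
    c η • wordSum {η}
  have sum_term (c) : formalSum (term c) = c := formalSum_smul_wordSum_singleton c
  have mul_eq_sum (c d) : d * c = formalSum fun η => d * term c η := by
    rw [← mul_formalSum (isLocallyFinite_wordSum_singleton.smul c), sum_term]
  have coeff (η ξ ζ : Word m) :
      (term c η * term d ξ) ζ = c η * d ξ * (shuffleWord η ξ).count ζ := by
    rw [smul_mul_smul_comm, ← wordSum_shuffleWord, ShuffleSeries.smul_apply, wordSum_apply]
  ext ζ
  calc shuffle c d ζ
    _ = ∑ᶠ (η) (ξ), c η * d ξ * (shuffleWord η ξ).count ζ :=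
      finsum_curry _ (shuffle_finite_support c d ζ)
    _ = ∑ᶠ η, (formalSum fun ξ => term c η * term d ξ) ζ := by simp only [formalSum_apply, coeff]
    _ = (formalSum fun η => d * term c η) ζ :=
      finsum_congr fun η => congrFun ((mul_eq_sum d _).symm.trans (mul_comm _ _)) ζ
    _ = (c * d) ζ := by rw [← mul_eq_sum, mul_comm]

theorem letterMul_eq_prepend (i : Fin (m + 1)) (e : ShuffleSeries (Fin (m + 1)) ℝ) :
    letterMul i e = prepend i e := by
  funext η
  cases η <;> rfl

theorem phiLetter_eq (d : Fin m → ShuffleSeries (Fin (m + 1)) ℝ) (i : Fin (m + 1))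
    (e : ShuffleSeries (Fin (m + 1)) ℝ) :
    phiLetter d i e = prepend i e + prepend 0 (Fin.cases 0 d i * e) :=
  congrArg₂ (· + ·) (letterMul_eq_prepend i e)
    ((congrArg (letterMul 0) (shuffle_eq_mul _ e)).trans (letterMul_eq_prepend 0 _))

theorem phi_oneSeries (d : Fin m → ShuffleSeries (Fin (m + 1)) ℝ) (η : Word m) :
    phi d η (oneSeries m) = wordImage d η := by
  induction η with
  | nil => funext ξ; cases ξ <;> rfl
  | cons i η ih => exact (congrArg (phiLetter d i) ih).trans (phiLetter_eq d i _)

theorem feedbackProd_eq_mul (c d : FeedbackGroup m ℝ) : feedbackProd c d = c * d := by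
  refine funext fun i => congrArg (d i + ·) (funext fun ξ => ?_)
  exact finsum_congr fun η => congrArg (c i η * ·) (congrFun (phi_oneSeries d η) ξ)

theorem deg_eq (i : Fin m) (η : Word m) : deg (i, η) = (η.map letterWeight).sum + 1 := by
  refine congrArg (· + 1) ?_
  induction η with
  | nil => simp
  | cons j η ih =>
    rw [List.map_cons, List.sum_cons, ← ih]
    cases j using Fin.cases with
    | zero =>
      simp only [letterWeight, if_true, List.count_cons_self,
        List.count_cons_of_ne (Fin.succ_ne_zero _).symm]
      ring
    | succ j =>
      simp only [letterWeight_succ, List.count_cons_of_ne (Fin.succ_ne_zero j), List.count_cons,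
        beq_iff_eq, Fin.succ_inj, Finset.sum_add_distrib, Finset.sum_ite_eq, Finset.mem_univ,
        if_true]
      ring

end RealCoefficients

section TensorGrading

variable {A : Type*} [CommRing A] [Algebra ℝ A] {𝒜 : ℕ → Submodule ℝ A}

theorem tmul_mem_tensorGrading {k l : ℕ} {a b : A} (ha : a ∈ 𝒜 k) (hb : b ∈ 𝒜 l) :
    a ⊗ₜ[ℝ] b ∈ tensorGrading 𝒜 (k + l) := by
  have mem_antidiagonal : (k, l) ∈ Finset.HasAntidiagonal.antidiagonal (k + l) := by simp
  exact Submodule.mem_iSup_of_mem (k, l) <| Submodule.mem_iSup_of_mem mem_antidiagonal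
    ⟨(⟨a, ha⟩ : 𝒜 k) ⊗ₜ[ℝ] (⟨b, hb⟩ : 𝒜 l), rfl⟩

theorem tensorGrading_le {n : ℕ} {P : Submodule ℝ (A ⊗[ℝ] A)}
    (h : ∀ k l, k + l = n → ∀ a ∈ 𝒜 k, ∀ b ∈ 𝒜 l, a ⊗ₜ[ℝ] b ∈ P) : tensorGrading 𝒜 n ≤ P := by
  refine iSup₂_le fun p hp => ?_
  rintro _ ⟨t, rfl⟩
  induction t with
  | zero => rw [map_zero]; exact zero_mem P
  | tmul a b => exact h p.1 p.2 (Finset.HasAntidiagonal.mem_antidiagonal.mp hp) a a.2 b b.2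
  | add s t hs ht => rw [map_add]; exact add_mem hs ht

instance tensorGrading.gradedMonoid [SetLike.GradedMonoid 𝒜] :
    SetLike.GradedMonoid (tensorGrading 𝒜) where
  one_mem := tmul_mem_tensorGrading (k := 0) (l := 0) SetLike.GradedOne.one_mem
    SetLike.GradedOne.one_mem
  mul_mem i j x y hx hy := by
    refine tensorGrading_le (P := (tensorGrading 𝒜 (i + j)).comap (LinearMap.mulRight ℝ y))
      (fun k l hkl a ha b hb => ?_) hx
    refine tensorGrading_le (P := (tensorGrading 𝒜 (i + j)).comap (LinearMap.mulLeft ℝ (a ⊗ₜ[ℝ] b)))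
      (fun k' l' hkl' a' ha' b' hb' => ?_) hy
    rw [Submodule.mem_comap, LinearMap.mulLeft_apply, Algebra.TensorProduct.tmul_mul_tmul,
      ← hkl, ← hkl', add_add_add_comm]
    exact tmul_mem_tensorGrading (SetLike.mul_mem_graded ha ha') (SetLike.mul_mem_graded hb hb')

end TensorGrading

section Grading

variable {m : ℕ}

instance grading.gradedMonoid : SetLike.GradedMonoid (grading m) :=
  MvPolynomial.WeightedHomogeneousSubmodule.gradedMonoid

theorem grading_isInternal : DirectSum.IsInternal (grading m) :=
  letI := MvPolynomial.weightedDecomposition ℝ (deg (m := m))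
  DirectSum.Decomposition.isInternal (MvPolynomial.weightedHomogeneousSubmodule ℝ (deg (m := m)))

theorem grading_zero : grading m 0 = Submodule.span ℝ {1} := by
  refine le_antisymm (fun a ha => ?_) ?_
  · have deg_ne_zero (p : Fin m × Word m) : deg p ≠ 0 := Nat.succ_ne_zero _
    rw [Submodule.mem_span_singleton,
      ← MvPolynomial.IsWeightedHomogeneous.weightedHomogeneousComponent_same ha,
      MvPolynomial.weightedHomogeneousComponent_zero a deg_ne_zero]
    exact ⟨a.coeff 0, MvPolynomial.C_eq_smul_one.symm⟩
  · exact (Submodule.span_singleton_le_iff_mem _ _).mpr SetLike.GradedOne.one_mem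

theorem counit_eq_zero_of_mem_grading {n : ℕ} (hn : 0 < n) {a : H m} (ha : a ∈ grading m n) :
    counit m a = 0 := by
  rw [counit, MvPolynomial.aeval_zero', MvPolynomial.constantCoeff_eq,
    MvPolynomial.IsWeightedHomogeneous.coeff_eq_zero ha 0 (by simpa using hn.ne), map_zero]

theorem coord_mem_grading (i : Fin m) (η : Word m) : coord i η ∈ grading m (deg (i, η)) :=
  MvPolynomial.isWeightedHomogeneous_X ℝ deg (i, η)

theorem map_mem_of_mem_grading {B : Type*} [CommRing B] [Algebra ℝ B] {ℬ : ℕ → Submodule ℝ B}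
    [SetLike.GradedMonoid ℬ] {f : H m →ₐ[ℝ] B} (hf : ∀ i η, f (coord i η) ∈ ℬ (deg (i, η))) {n : ℕ}
    {a : H m} (ha : a ∈ grading m n) : f a ∈ ℬ n := by
  refine MvPolynomial.IsWeightedHomogeneous.induction_on
    (motive := fun p _ => f p ∈ ℬ n) ?_ (fun p q _ _ hp hq => ?_) (fun d r hd => ?_) ha
  · rw [map_zero]
    exact zero_mem _
  · rw [map_add]
    exact add_mem hp hq
  · rw [MvPolynomial.monomial_eq, ← MvPolynomial.algebraMap_eq, ← Algebra.smul_def, map_smul,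
      Finsupp.prod, map_prod, ← hd, Finsupp.weight_apply]
    simp only [map_pow]
    exact Submodule.smul_mem _ _ (SetLike.prod_pow_mem_graded ℬ _ _ _ fun p _ => hf p.1 p.2)

end Grading

section HopfAlgebra

variable {m : ℕ} {B C : Type*} [CommRing B] [Algebra ℝ B] [CommRing C] [Algebra ℝ C]

/-- `H m` represents the output feedback group: an algebra morphism `f : H m → B` is the same as the
tuple of series over `B` with the coefficients `f (a^i_η)`. -/
def points : (H m →ₐ[ℝ] B) ≃ FeedbackGroup m B where
  toFun f i η := f (coord i η)
  invFun c := MvPolynomial.aeval fun p => c p.1 p.2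
  left_inv _ := MvPolynomial.algHom_ext fun p => MvPolynomial.aeval_X _ p
  right_inv _ := FeedbackGroup.ext fun i η => MvPolynomial.aeval_X _ (i, η)

theorem points_apply (f : H m →ₐ[ℝ] B) (i : Fin m) (η : Word m) : points f i η = f (coord i η) :=
  rfl

theorem map_points (g : B →ₐ[ℝ] C) (f : H m →ₐ[ℝ] B) :
    FeedbackGroup.map (g : B →+* C) (points f) = points (g.comp f) := rfl

/-- The coproduct of `H m`: the product in the output feedback group of the two points of `H m` over
`H m ⊗ H m`. -/
def comulHom (m : ℕ) : H m →ₐ[ℝ] H m ⊗[ℝ] H m :=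
  points.symm (points Algebra.TensorProduct.includeLeft * points Algebra.TensorProduct.includeRight)

/-- The antipode of `H m`: the inverse in the output feedback group of the universal point. -/
def antipodeHom (m : ℕ) : H m →ₐ[ℝ] H m := points.symm (points (.id ℝ (H m)))⁻¹

theorem points_comp_comulHom (f : H m ⊗[ℝ] H m →ₐ[ℝ] B) :
    points (f.comp (comulHom m)) = points (f.comp Algebra.TensorProduct.includeLeft) *
      points (f.comp Algebra.TensorProduct.includeRight) := by
  rw [← map_points, comulHom, Equiv.apply_symm_apply, map_mul, map_points, map_points]

theorem points_productMap_comp_comulHom (f g : H m →ₐ[ℝ] B) :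
    points ((Algebra.TensorProduct.productMap f g).comp (comulHom m)) = points f * points g := by
  rw [points_comp_comulHom, Algebra.TensorProduct.productMap_left,
    Algebra.TensorProduct.productMap_right]

theorem points_antipodeHom : points (antipodeHom m) = (points (.id ℝ (H m)))⁻¹ :=
  points.apply_symm_apply _

theorem points_comp_counit (f : ℝ →ₐ[ℝ] B) : points (f.comp (counit m)) = 1 :=
  FeedbackGroup.ext fun i η => by
    rw [points_apply, AlgHom.comp_apply, counit, coord, MvPolynomial.aeval_X, map_zero]
    rfl

theorem points_comp_map_comulHom_id (f : (H m ⊗[ℝ] H m) ⊗[ℝ] H m →ₐ[ℝ] B) :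
    points (f.comp ((Algebra.TensorProduct.map (comulHom m) (.id ℝ (H m))).comp (comulHom m))) =
      points ((f.comp Algebra.TensorProduct.includeLeft).comp Algebra.TensorProduct.includeLeft) *
        points ((f.comp Algebra.TensorProduct.includeLeft).comp
          Algebra.TensorProduct.includeRight) *
        points (f.comp Algebra.TensorProduct.includeRight) := by
  rw [← AlgHom.comp_assoc, points_comp_comulHom, AlgHom.comp_assoc, AlgHom.comp_assoc,
    Algebra.TensorProduct.map_comp_includeLeft, Algebra.TensorProduct.map_comp_includeRight,
    ← AlgHom.comp_assoc, points_comp_comulHom, AlgHom.comp_id]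

theorem points_comp_map_id_comulHom (f : H m ⊗[ℝ] (H m ⊗[ℝ] H m) →ₐ[ℝ] B) :
    points (f.comp ((Algebra.TensorProduct.map (.id ℝ (H m)) (comulHom m)).comp (comulHom m))) =
      points (f.comp Algebra.TensorProduct.includeLeft) *
        (points ((f.comp Algebra.TensorProduct.includeRight).comp
          Algebra.TensorProduct.includeLeft) *
        points ((f.comp Algebra.TensorProduct.includeRight).comp
          Algebra.TensorProduct.includeRight)) := by
  rw [← AlgHom.comp_assoc, points_comp_comulHom, AlgHom.comp_assoc, AlgHom.comp_assoc,
    Algebra.TensorProduct.map_comp_includeLeft, Algebra.TensorProduct.map_comp_includeRight,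
    ← AlgHom.comp_assoc, ← AlgHom.comp_assoc, points_comp_comulHom, AlgHom.comp_id]

/-- With the triple tensor product itself in place of `B`, unifying the two paths to its semiring
structure in the rewriting below would be too slow. -/
theorem comp_comulHom_coassoc (f : H m ⊗[ℝ] (H m ⊗[ℝ] H m) →ₐ[ℝ] B) :
    (f.comp (Algebra.TensorProduct.assoc ℝ ℝ ℝ (H m) (H m) (H m)).toAlgHom).comp
      ((Algebra.TensorProduct.map (comulHom m) (.id ℝ (H m))).comp (comulHom m))
      = f.comp ((Algebra.TensorProduct.map (.id ℝ (H m)) (comulHom m)).comp (comulHom m)) := by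
  apply points.injective
  rw [points_comp_map_comulHom_id, points_comp_map_id_comulHom, mul_assoc]
  rfl

theorem comulHom_coassoc : (Algebra.TensorProduct.assoc ℝ ℝ ℝ (H m) (H m) (H m)).toAlgHom.comp
      ((Algebra.TensorProduct.map (comulHom m) (.id ℝ (H m))).comp (comulHom m))
      = (Algebra.TensorProduct.map (.id ℝ (H m)) (comulHom m)).comp (comulHom m) := by
  have id_comp_comulHom_coassoc := comp_comulHom_coassoc (m := m)
    (B := H m ⊗[ℝ] (H m ⊗[ℝ] H m)) (AlgHom.id ℝ (H m ⊗[ℝ] (H m ⊗[ℝ] H m)))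
  exact id_comp_comulHom_coassoc

theorem comulHom_counit_left :
    (Algebra.TensorProduct.map (counit m) (.id ℝ (H m))).comp (comulHom m)
      = (Algebra.TensorProduct.lid ℝ (H m)).symm := by
  apply points.injective
  rw [points_comp_comulHom, Algebra.TensorProduct.map_comp_includeLeft,
    Algebra.TensorProduct.map_comp_includeRight, points_comp_counit, one_mul, AlgHom.comp_id]
  rfl

theorem comulHom_counit_right :
    (Algebra.TensorProduct.map (.id ℝ (H m)) (counit m)).comp (comulHom m)
      = (Algebra.TensorProduct.rid ℝ ℝ (H m)).symm := by
  apply points.injective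
  rw [points_comp_comulHom, Algebra.TensorProduct.map_comp_includeLeft,
    Algebra.TensorProduct.map_comp_includeRight, points_comp_counit, mul_one, AlgHom.comp_id]
  rfl

theorem productMap_antipodeHom_id_comp_comulHom :
    (Algebra.TensorProduct.productMap (antipodeHom m) (.id ℝ (H m))).comp (comulHom m) =
      (Algebra.ofId ℝ (H m)).comp (counit m) := by
  apply points.injective
  rw [points_productMap_comp_comulHom, points_antipodeHom, inv_mul_cancel, points_comp_counit]

theorem productMap_id_antipodeHom_comp_comulHom :
    (Algebra.TensorProduct.productMap (.id ℝ (H m)) (antipodeHom m)).comp (comulHom m) =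
      (Algebra.ofId ℝ (H m)).comp (counit m) := by
  apply points.injective
  rw [points_productMap_comp_comulHom, points_antipodeHom, mul_inv_cancel, points_comp_counit]

/-- The Hopf algebra of the output feedback group. -/
abbrev hopfAlgebra (m : ℕ) : HopfAlgebra ℝ (H m) :=
  letI : Bialgebra ℝ (H m) :=
    .ofAlgHom (comulHom m) (counit m) comulHom_coassoc comulHom_counit_left comulHom_counit_right
  .ofAlgHom (antipodeHom m) productMap_antipodeHom_id_comp_comulHom
    productMap_id_antipodeHom_comp_comulHom

theorem points_evalAt (c : FeedbackGroup m ℝ) : points (evalAt c) = c := points.apply_symm_apply c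

theorem comulHom_isDualCoproduct : IsDualCoproduct (comulHom m) :=
  fun i η (c d : FeedbackGroup m ℝ) => calc
    evalPair c d (comulHom m (coord i η))
      = points ((evalPair c d).comp (comulHom m)) i η := rfl
    _ = (points (evalAt c) * points (evalAt d)) i η :=
      congrFun (congrFun (points_productMap_comp_comulHom _ _) i) η
    _ = feedbackProd c d i η := by rw [points_evalAt, points_evalAt, feedbackProd_eq_mul]

theorem evalPair_injective {x y : H m ⊗[ℝ] H m} (h : ∀ c d, evalPair c d x = evalPair c d y) :
    x = y := by
  let e := MvPolynomial.tensorEquivSum ℝ (Fin m × Word m) (Fin m × Word m) ℝ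
  have eval_e (v : (Fin m × Word m) ⊕ (Fin m × Word m) → ℝ) (z : H m ⊗[ℝ] H m) :
      MvPolynomial.eval v (e z) =
        evalPair (fun i η => v (.inl (i, η))) (fun i η => v (.inr (i, η))) z := by
    have aeval_comp_e : (MvPolynomial.aeval v).comp e.toAlgHom =
        evalPair (fun i η => v (.inl (i, η))) (fun i η => v (.inr (i, η))) := by
      ext p <;> simp [e, evalPair, evalAt]
    rw [← MvPolynomial.coe_aeval_eq_eval]
    exact DFunLike.congr_fun aeval_comp_e z
  refine e.injective (MvPolynomial.funext fun v => ?_)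
  rw [eval_e, eval_e, h]

theorem IsDualCoproduct.eq_comulHom {Δ : H m →ₐ[ℝ] H m ⊗[ℝ] H m} (h : IsDualCoproduct Δ) :
    Δ = comulHom m :=
  MvPolynomial.algHom_ext fun p => evalPair_injective fun c d =>
    (h p.1 p.2 c d).trans (comulHom_isDualCoproduct p.1 p.2 c d).symm

theorem points_mem_homogeneousSubgroup_iff {ℬ : ℕ → Submodule ℝ B} [SetLike.GradedMonoid ℬ]
    {f : H m →ₐ[ℝ] B} :
    points f ∈ FeedbackGroup.homogeneousSubgroup m ℬ ↔
      ∀ n, ∀ a ∈ grading m n, f a ∈ ℬ n := by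
  refine ⟨fun h n a ha => map_mem_of_mem_grading (fun i η => ?_) ha, fun h i η => ?_⟩
  · rw [deg_eq]
    exact h i η
  · rw [← deg_eq i η]
    exact h _ _ (coord_mem_grading i η)

theorem comulHom_mem_tensorGrading {n : ℕ} {a : H m} (ha : a ∈ grading m n) :
    comulHom m a ∈ tensorGrading (grading m) n := by
  refine points_mem_homogeneousSubgroup_iff.mp ?_ n a ha
  rw [comulHom, Equiv.apply_symm_apply]
  refine mul_mem (points_mem_homogeneousSubgroup_iff.mpr fun k b hb => ?_)
    (points_mem_homogeneousSubgroup_iff.mpr fun k b hb => ?_)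
  · exact tmul_mem_tensorGrading (l := 0) hb SetLike.GradedOne.one_mem
  · rw [← zero_add k]
    exact tmul_mem_tensorGrading SetLike.GradedOne.one_mem hb

theorem antipodeHom_mem_grading {n : ℕ} {a : H m} (ha : a ∈ grading m n) :
    antipodeHom m a ∈ grading m n := by
  refine points_mem_homogeneousSubgroup_iff.mp ?_ n a ha
  rw [points_antipodeHom]
  exact inv_mem (points_mem_homogeneousSubgroup_iff.mpr fun _ _ => id)

theorem comulHom_isConnectedGradedHopfAlgebra :
    IsConnectedGradedHopfAlgebra (grading m) (comulHom m) (counit m) where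
  coassoc := comulHom_coassoc
  counit_left := comulHom_counit_left
  counit_right := comulHom_counit_right
  isInternal := grading_isInternal
  gradedMonoid := grading.gradedMonoid
  connected := grading_zero
  comul_mem _ _ ha := comulHom_mem_tensorGrading ha
  counit_eq_zero _ hn _ ha := counit_eq_zero_of_mem_grading hn ha
  exists_antipode := ⟨hopfAlgebra m, rfl,
    fun a b => ((antipodeHom m).map_mul a b).trans (mul_comm _ _),
    fun _ _ ha => antipodeHom_mem_grading ha⟩

end HopfAlgebra

end OutputFeedback

end

theorem mainTheorem1 (m : ℕ) :
    (∃! Δ : OutputFeedback.H m →ₐ[ℝ] OutputFeedback.H m ⊗[ℝ] OutputFeedback.H m,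
      OutputFeedback.IsDualCoproduct Δ) ∧
    ∀ Δ : OutputFeedback.H m →ₐ[ℝ] OutputFeedback.H m ⊗[ℝ] OutputFeedback.H m,
      OutputFeedback.IsDualCoproduct Δ →
        OutputFeedback.IsConnectedGradedHopfAlgebra (OutputFeedback.grading m) Δ
          (OutputFeedback.counit m) := by
  refine ⟨⟨OutputFeedback.comulHom m, OutputFeedback.comulHom_isDualCoproduct,
    fun Δ hΔ => hΔ.eq_comulHom⟩, fun Δ hΔ => ?_⟩
  rw [hΔ.eq_comulHom]
  exact OutputFeedback.comulHom_isConnectedGradedHopfAlgebra
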